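/- Let $\mathcal H$ be a real Hilbert space, $\mathcal D$ a subset of a normed space $\mathcal G$ (with the induced topology), and $I_1, I_2$ finite index sets. For $i\in I_1\cup I_2$ let $f_i:\mathcal D\to\mathbb R$ and $g_i:\mathcal D\to\mathcal H$ be locally Lipschitz on $\mathcal D$. For $p\in\mathcal D$ put $$C(p)=\{x\in\mathcal H \mid \langle x\mid g_i(p)\rangle = f_i(p)\ (i\in I_1),\ \ \langle x\mid g_i(p)\rangle\le f_i(p)\ (i\in I_2)\},$$ and, whenever $C(p)\neq\emptyset$, let $P(v,p)$ denote the projection of $v\in\mathcal H$ onto $C(p)$, i.e. the unique minimizer of $\tfrac12\|x-v\|^2$ over $x\in C(p)$. For $x\in\mathcal H$ let $I_p(x)=\{i\in I_1\cup I_2\mid \langle x\mid g_i(p)\rangle=f_i(p)\}$. Let $\bar p\in\mathcal D$ with $C(\bar p)\ne\emptyset$ and let $\bar v\in\mathcal H\setminus C(\bar p)$. Assume that LICQ holds for $C(\bar p)$ at $P(\bar v,\bar p)$, i.e. the vectors $g_i(\bar p)$, $i\in I_{\bar p}(P(\bar v,\bar p))$, are linearly independent. Then there exist a neighbourhood $W$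 of $\bar v$ in $\mathcal H$, a neighbourhood $U$ of $\bar p$ in $\mathcal D$ and a constant $\ell^0>0$ such that $C(p)\neq\emptyset$ for all $p\in U$ and $$\|(v_1-v_2)-2[P(v_1,p_1)-P(v_2,p_2)]\|\le\|v_1-v_2\|+\ell^0\|p_1-p_2\|$$ for all $(v_1,p_1),(v_2,p_2)\in W\times U$. -/

import Mathlib

/-- The polyhedral set
`{x | ⟨x, gᵢ(p)⟩ = fᵢ(p) for i ∈ I₁, ⟨x, gᵢ(p)⟩ ≤ fᵢ(p) for i ∈ I₂}` at the parameter `p`. -/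
def feasibleSet {ι P H : Type*} [NormedAddCommGroup H] [InnerProductSpace ℝ H]
    (I₁ I₂ : Finset ι) (f : ι → P → ℝ) (g : ι → P → H) (p : P) : Set H :=
  {x | (∀ i ∈ I₁, inner ℝ x (g i p) = f i p) ∧ (∀ i ∈ I₂, inner ℝ x (g i p) ≤ f i p)}

/-- The active index set `{i ∈ I₁ ∪ I₂ | ⟨x, gᵢ(p)⟩ = fᵢ(p)}` of the parameter `p` at `x`. -/
def activeSet {ι P H : Type*} [NormedAddCommGroup H] [InnerProductSpace ℝ H]
    (I₁ I₂ : Finset ι) (f : ι → P → ℝ) (g : ι → P → H) (p : P) (x : H) : Set ι :=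
  {i | (i ∈ I₁ ∨ i ∈ I₂) ∧ inner ℝ x (g i p) = f i p}

/-- The linear independence constraint qualification at `x`: the family of the active gradients
`gᵢ(p)` is linearly independent. -/
def LICQ {ι P H : Type*} [NormedAddCommGroup H] [InnerProductSpace ℝ H]
    (I₁ I₂ : Finset ι) (f : ι → P → ℝ) (g : ι → P → H) (p : P) (x : H) : Prop :=
  LinearIndependent ℝ (fun i : activeSet I₁ I₂ f g p x => g i p)

/-- `x` solves the problem: minimize `½‖x - v‖²` over `x ∈ C`. -/
def IsProjection {H : Type*} [NormedAddCommGroup H] (C : Set H) (v x : H) : Prop :=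
  x ∈ C ∧ IsMinOn (fun y : H => (1 / 2 : ℝ) * ‖y - v‖ ^ 2) C x

/-- The projection of `v` onto `C`: the minimizer of `½‖x - v‖²` over `x ∈ C`
(an arbitrary point if there is none; for the nonempty sets `feasibleSet I₁ I₂ f g p` in a Hilbert
space there is exactly one, see `existsUnique_isProjection_feasibleSet`). -/
noncomputable def projection {H : Type*} [NormedAddCommGroup H] (C : Set H) (v : H) : H :=
  Classical.epsilon (IsProjection C v)

theorem isClosed_feasibleSet {ι P H : Type*} [NormedAddCommGroup H] [InnerProductSpace ℝ H]
    (I₁ I₂ : Finset ι) (f : ι → P → ℝ) (g : ι → P → H) (p : P) :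
    IsClosed (feasibleSet I₁ I₂ f g p) := by
  have h : feasibleSet I₁ I₂ f g p =
      (⋂ i ∈ I₁, {x | inner ℝ x (g i p) = f i p}) ∩
        (⋂ i ∈ I₂, {x | inner ℝ x (g i p) ≤ f i p}) := by
    ext x
    simp [feasibleSet]
  rw [h]
  refine IsClosed.inter ?_ ?_
  · exact isClosed_biInter fun i _ => isClosed_eq (by fun_prop) (by fun_prop)
  · exact isClosed_biInter fun i _ => isClosed_le (by fun_prop) (by fun_prop)

theorem convex_feasibleSet {ι P H : Type*} [NormedAddCommGroup H] [InnerProductSpace ℝ H]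
    (I₁ I₂ : Finset ι) (f : ι → P → ℝ) (g : ι → P → H) (p : P) :
    Convex ℝ (feasibleSet I₁ I₂ f g p) := by
  intro x hx y hy a b ha hb hab
  constructor
  · intro i hi
    rw [inner_add_left, real_inner_smul_left, real_inner_smul_left, hx.1 i hi, hy.1 i hi,
      ← add_mul, hab, one_mul]
  · intro i hi
    rw [inner_add_left, real_inner_smul_left, real_inner_smul_left]
    have h1 := mul_le_mul_of_nonneg_left (hx.2 i hi) ha
    have h2 := mul_le_mul_of_nonneg_left (hy.2 i hi) hb
    calc _ ≤ a * f i p + b * f i p := add_le_add h1 h2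
      _ = f i p := by rw [← add_mul, hab, one_mul]

/-- A nonempty closed convex subset of a Hilbert space has exactly one nearest point to `v`. -/
theorem existsUnique_isProjection {H : Type*} [NormedAddCommGroup H] [InnerProductSpace ℝ H]
    [CompleteSpace H] {C : Set H} (hne : C.Nonempty) (hcl : IsClosed C) (hco : Convex ℝ C)
    (v : H) : ∃! x, IsProjection C v x := by
  obtain ⟨x, hx, hmin⟩ := exists_norm_eq_iInf_of_complete_convex hne hcl.isComplete hco v
  have hvar := (norm_eq_iInf_iff_real_inner_le_zero hco hx).1 hmin
  have key : ∀ y ∈ C, ‖x - v‖ ^ 2 + ‖y - x‖ ^ 2 ≤ ‖y - v‖ ^ 2 := by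
    intro y hy
    have h1 : y - v = (y - x) - (v - x) := by abel
    have h2 := hvar y hy
    rw [real_inner_comm] at h2
    rw [h1, norm_sub_rev x v, norm_sub_sq_real (y - x) (v - x)]
    linarith
  refine ⟨x, ⟨hx, ?_⟩, ?_⟩
  · intro y hy
    have := key y hy
    have h0 := sq_nonneg ‖y - x‖
    show (1 / 2 : ℝ) * ‖x - v‖ ^ 2 ≤ 1 / 2 * ‖y - v‖ ^ 2
    linarith
  · rintro y ⟨hy, hymin⟩
    have h1 := key y hy
    have h2 : (1 / 2 : ℝ) * ‖y - v‖ ^ 2 ≤ 1 / 2 * ‖x - v‖ ^ 2 := hymin hx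
    have h3 : ‖y - x‖ ^ 2 ≤ 0 := by linarith
    have h4 : ‖y - x‖ = 0 := by
      have := sq_nonneg ‖y - x‖
      exact pow_eq_zero_iff (two_ne_zero) |>.1 (le_antisymm h3 this)
    exact sub_eq_zero.1 (norm_eq_zero.1 h4)

theorem existsUnique_isProjection_feasibleSet {ι P H : Type*} [NormedAddCommGroup H]
    [InnerProductSpace ℝ H] [CompleteSpace H]
    (I₁ I₂ : Finset ι) (f : ι → P → ℝ) (g : ι → P → H) (p : P)
    (hne : (feasibleSet I₁ I₂ f g p).Nonempty) (v : H) :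
    ∃! x, IsProjection (feasibleSet I₁ I₂ f g p) v x :=
  existsUnique_isProjection hne (isClosed_feasibleSet I₁ I₂ f g p)
    (convex_feasibleSet I₁ I₂ f g p) v

/-- `projection` is the minimizer whenever one exists. -/
theorem isProjection_projection {H : Type*} [NormedAddCommGroup H] {C : Set H} {v : H}
    (h : ∃ x, IsProjection C v x) : IsProjection C v (projection C v) :=
  Classical.epsilon_spec h

/-! For fixed `p`, the projection is firmly nonexpansive, so the reflection `v ↦ v - 2 P(v, p)` is
nonexpansive up to sign (`IsProjection.norm_reflection_sub_le`). It thus suffices that `P(v, ·)` be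
Lipschitz near `pbar`, uniformly for `v` near `vbar`; the triangle inequality then costs twice that
Lipschitz constant.

Keep only the constraints active at `(xbar, pbar)`, where `xbar` is the projection of `vbar`. By
LICQ all remaining gradients are independent at `pbar`, hence near `pbar` with a uniform coefficient
bound. This yields nonempty reduced sets and bounded KKT multipliers. Comparing the KKT systems at
two parameters gives `e² ≤ a e d + b d²`, with `e` the distance of the projections and `d` that of
the parameters, so `e = O(d)` (`IsMultiplier.norm_sub_le`, `exists_lipschitz_projection`).

The reduced projection is therefore jointly continuous, and the dropped inequalities stay strict
along it near `(vbar, pbar)`. There it is feasible for the full system and equals the original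
projection. -/

/-! ### Projections onto convex sets. -/

theorem isProjection_iff_inner_nonpos {H : Type*} [NormedAddCommGroup H] [InnerProductSpace ℝ H]
    {C : Set H} (hC : Convex ℝ C) {v x : H} :
    IsProjection C v x ↔ x ∈ C ∧ ∀ y ∈ C, inner ℝ (v - x) (y - x) ≤ 0 := by
  refine and_congr_right fun hx => ⟨fun h => ?_, fun h y hy => ?_⟩
  · refine (norm_eq_iInf_iff_real_inner_le_zero hC hx).1 (le_antisymm ?_ ?_)
    · have : Nonempty C := ⟨⟨x, hx⟩⟩
      refine le_ciInf fun y => ?_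
      have h1 : (1 / 2 : ℝ) * ‖x - v‖ ^ 2 ≤ 1 / 2 * ‖(y : H) - v‖ ^ 2 := h y.2
      rw [norm_sub_rev v x, norm_sub_rev v]
      exact le_of_sq_le_sq (by linarith) (norm_nonneg _)
    · exact ciInf_le ⟨0, by rintro _ ⟨y, rfl⟩; exact norm_nonneg _⟩ (⟨x, hx⟩ : C)
  · have h1 : y - v = (y - x) - (v - x) := by abel
    have h2 := h y hy
    rw [real_inner_comm] at h2
    have h3 := norm_sub_sq_real (y - x) (v - x)
    rw [← h1, norm_sub_rev v x] at h3
    have := sq_nonneg ‖y - x‖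
    show (1 / 2 : ℝ) * ‖x - v‖ ^ 2 ≤ 1 / 2 * ‖y - v‖ ^ 2
    linarith

theorem IsProjection.firmly_nonexpansive {H : Type*} [NormedAddCommGroup H]
    [InnerProductSpace ℝ H] {C : Set H} (hC : Convex ℝ C) {v₁ v₂ x₁ x₂ : H}
    (h₁ : IsProjection C v₁ x₁) (h₂ : IsProjection C v₂ x₂) :
    ‖x₁ - x₂‖ ^ 2 ≤ inner ℝ (v₁ - v₂) (x₁ - x₂) := by
  rw [isProjection_iff_inner_nonpos hC] at h₁ h₂
  have a := h₁.2 _ h₂.1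
  have b := h₂.2 _ h₁.1
  have e : inner ℝ (v₁ - v₂) (x₁ - x₂) =
      inner ℝ (x₁ - x₂) (x₁ - x₂) - inner ℝ (v₁ - x₁) (x₂ - x₁) - inner ℝ (v₂ - x₂) (x₁ - x₂) := by
    simp only [inner_sub_left, inner_sub_right]; ring
  rw [e, real_inner_self_eq_norm_sq]
  linarith

theorem IsProjection.norm_sub_le {H : Type*} [NormedAddCommGroup H]
    [InnerProductSpace ℝ H] {C : Set H} (hC : Convex ℝ C) {v₁ v₂ x₁ x₂ : H}
    (h₁ : IsProjection C v₁ x₁) (h₂ : IsProjection C v₂ x₂) :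
    ‖x₁ - x₂‖ ≤ ‖v₁ - v₂‖ := by
  have h := (h₁.firmly_nonexpansive hC h₂).trans (real_inner_le_norm _ _)
  by_contra! hlt
  nlinarith [norm_nonneg (v₁ - v₂)]

/-- With `w = v₁ - v₂` and `d = x₁ - x₂`, `‖w - 2d‖² = ‖w‖² - 4(⟨w, d⟩ - ‖d‖²)`, and the bracket is
nonnegative by firm nonexpansiveness. -/
theorem IsProjection.norm_reflection_sub_le {H : Type*} [NormedAddCommGroup H]
    [InnerProductSpace ℝ H] {C : Set H} (hC : Convex ℝ C) {v₁ v₂ x₁ x₂ : H}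
    (h₁ : IsProjection C v₁ x₁) (h₂ : IsProjection C v₂ x₂) :
    ‖(v₁ - v₂) - (2 : ℝ) • (x₁ - x₂)‖ ≤ ‖v₁ - v₂‖ := by
  have h := h₁.firmly_nonexpansive hC h₂
  refine le_of_sq_le_sq ?_ (norm_nonneg _)
  rw [norm_sub_sq_real, inner_smul_right, norm_smul, Real.norm_ofNat]
  nlinarith

theorem IsProjection.projection_eq {H : Type*} [NormedAddCommGroup H] [InnerProductSpace ℝ H]
    {C : Set H} (hC : Convex ℝ C) {v x : H} (h : IsProjection C v x) :
    projection C v = x := by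
  have := (isProjection_projection ⟨x, h⟩).norm_sub_le hC h
  rw [sub_self, norm_zero] at this
  exact sub_eq_zero.1 (norm_le_zero_iff.1 this)

theorem isProjection_projection_feasibleSet {ι P H : Type*} [NormedAddCommGroup H]
    [InnerProductSpace ℝ H] [CompleteSpace H] {I₁ I₂ : Finset ι} {f : ι → P → ℝ}
    {g : ι → P → H} {p : P} (hne : (feasibleSet I₁ I₂ f g p).Nonempty) (v : H) :
    IsProjection (feasibleSet I₁ I₂ f g p) v (projection (feasibleSet I₁ I₂ f g p) v) :=
  isProjection_projection (existsUnique_isProjection_feasibleSet I₁ I₂ f g p hne v).exists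

/-! ### Quantitative linear independence. -/

/-- Linear independence of `gᵢ`, `i ∈ s`, with the coefficients controlled by the constant `c`. -/
def CoeffBound {ι H : Type*} [NormedAddCommGroup H] [InnerProductSpace ℝ H]
    (s : Finset ι) (g : ι → H) (c : ℝ) : Prop :=
  ∀ μ : ι → ℝ, ∑ i ∈ s, |μ i| ≤ c * ‖∑ i ∈ s, μ i • g i‖

theorem LinearIndependent.exists_coeffBound {ι H : Type*} [NormedAddCommGroup H]
    [InnerProductSpace ℝ H] {s : Finset ι} {g : ι → H}
    (h : LinearIndependent ℝ (fun i : s => g i)) : ∃ c, 0 < c ∧ CoeffBound s g c := by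
  obtain ⟨K, hK, hanti⟩ := (Fintype.linearCombination ℝ (fun i : s => g i)).exists_antilipschitzWith
    (LinearMap.ker_eq_bot.2 (linearIndependent_iff_injective_fintypeLinearCombination.1 h))
  refine ⟨(s.card + 1) * K, by positivity, fun μ => ?_⟩
  have h1 := hanti.le_mul_dist (fun i : s => μ i) 0
  simp only [map_zero, dist_zero_right, Fintype.linearCombination_apply] at h1
  rw [Finset.sum_coe_sort s (fun i => μ i • g i)] at h1
  have h2 : ∀ i ∈ s, |μ i| ≤ K * ‖∑ i ∈ s, μ i • g i‖ := fun i hi =>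
    (norm_le_pi_norm (fun i : s => μ i) ⟨i, hi⟩).trans h1
  refine (Finset.sum_le_card_nsmul _ _ _ h2).trans ?_
  rw [nsmul_eq_mul]
  have : 0 ≤ (K : ℝ) * ‖∑ i ∈ s, μ i • g i‖ := by positivity
  linarith

/-- A perturbation of size `1 / (2c)` contributes at most half of the coefficient sum, which is
absorbed on the left. -/
theorem CoeffBound.of_near {ι H : Type*} [NormedAddCommGroup H] [InnerProductSpace ℝ H]
    {s : Finset ι} {g g' : ι → H} {c : ℝ} (hc : 0 < c) (h : CoeffBound s g c)
    (hg : ∀ i ∈ s, ‖g i - g' i‖ ≤ 1 / (2 * c)) : CoeffBound s g' (2 * c) := by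
  intro μ
  have h1 : ‖∑ i ∈ s, μ i • g i‖ ≤ ‖∑ i ∈ s, μ i • g' i‖ + (∑ i ∈ s, |μ i|) * (1 / (2 * c)) := by
    have : ∑ i ∈ s, μ i • g i = ∑ i ∈ s, μ i • g' i + ∑ i ∈ s, μ i • (g i - g' i) := by
      rw [← Finset.sum_add_distrib]
      exact Finset.sum_congr rfl fun i _ => by rw [smul_sub]; abel
    rw [this, Finset.sum_mul]
    refine (norm_add_le _ _).trans (add_le_add le_rfl (norm_sum_le_of_le _ fun i hi => ?_))
    rw [norm_smul, Real.norm_eq_abs]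
    exact mul_le_mul_of_nonneg_left (hg i hi) (abs_nonneg _)
  have h2 := (h μ).trans (mul_le_mul_of_nonneg_left h1 hc.le)
  have h3 : c * ((∑ i ∈ s, |μ i|) * (1 / (2 * c))) = (∑ i ∈ s, |μ i|) / 2 := by field_simp
  rw [mul_add, h3] at h2
  linarith

/-- Orthogonal projection onto the span of a finite family, in terms of coefficients. -/
theorem exists_sub_sum_orthogonal {ι H : Type*} [NormedAddCommGroup H] [InnerProductSpace ℝ H]
    (s : Finset ι) (g : ι → H) (x : H) :
    ∃ μ : ι → ℝ, (∀ i ∈ s, inner ℝ (x - ∑ j ∈ s, μ j • g j) (g i) = 0) ∧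
      inner ℝ (x - ∑ j ∈ s, μ j • g j) (∑ j ∈ s, μ j • g j) = 0 := by
  have : FiniteDimensional ℝ (Submodule.span ℝ (g '' s)) :=
    FiniteDimensional.span_of_finite ℝ (s.finite_toSet.image g)
  obtain ⟨μ, hμ⟩ := (Submodule.mem_span_image_finset_iff_exists_fun' ℝ).1
    (Submodule.starProjection_apply_mem (Submodule.span ℝ (g '' s)) x)
  have horth : ∀ y ∈ Submodule.span ℝ (g '' s), inner ℝ (x - ∑ j ∈ s, μ j • g j) y = 0 := by
    rw [hμ]
    exact Submodule.starProjection_inner_eq_zero x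
  exact ⟨μ, fun i hi => horth _ (Submodule.subset_span ⟨i, hi, rfl⟩),
    horth _ (hμ ▸ Submodule.starProjection_apply_mem _ _)⟩

/-- A biorthogonal family whose norms are at most the coefficient constant. -/
theorem CoeffBound.exists_biorthogonal {ι H : Type*} [DecidableEq ι] [NormedAddCommGroup H]
    [InnerProductSpace ℝ H] {s : Finset ι} {g : ι → H} {c : ℝ} (hc : 0 < c)
    (h : CoeffBound s g c) : ∃ e : ι → H, ∀ j ∈ s, ‖e j‖ ≤ c ∧
      ∀ i ∈ s, inner ℝ (e j) (g i) = if i = j then 1 else 0 := by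
  suffices ∀ j, ∃ e : H, j ∈ s → ‖e‖ ≤ c ∧
      ∀ i ∈ s, inner ℝ e (g i) = if i = j then 1 else 0 by
    choose e he using this
    exact ⟨e, fun j hj => he j hj⟩
  intro j
  by_cases hj : j ∈ s
  swap
  · exact ⟨0, fun h => absurd h hj⟩
  -- The dual vector is the part of `g j` orthogonal to the other vectors, rescaled. The coefficient
  -- bound keeps the norm of that part at least `1 / c`.
  obtain ⟨μ, horth, hwK⟩ := exists_sub_sum_orthogonal (s.erase j) g (g j)
  obtain ⟨w, hμ⟩ : ∃ w, w = ∑ i ∈ s.erase j, μ i • g i := ⟨_, rfl⟩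
  rw [← hμ] at horth hwK
  have hu : 1 ≤ c * ‖g j - w‖ := by
    have h1 := h (fun i => if i = j then 1 else -μ i)
    rw [← Finset.add_sum_erase _ _ hj, ← Finset.add_sum_erase _ _ hj] at h1
    have h2 : ∑ i ∈ s.erase j, (if i = j then (1 : ℝ) else -μ i) • g i = - w := by
      rw [hμ, ← Finset.sum_neg_distrib]
      exact Finset.sum_congr rfl fun i hi => by rw [if_neg (Finset.ne_of_mem_erase hi), neg_smul]
    rw [h2, if_pos rfl, abs_one, one_smul, ← sub_eq_add_neg] at h1
    exact (le_add_of_nonneg_right (Finset.sum_nonneg fun i _ => abs_nonneg _)).trans h1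
  have hupos : 0 < ‖g j - w‖ := by
    by_contra! hle
    nlinarith
  refine ⟨(‖g j - w‖ ^ 2)⁻¹ • (g j - w), fun _ => ⟨?_, fun i hi => ?_⟩⟩
  · rw [norm_smul, norm_inv, norm_pow, norm_norm, inv_mul_le_iff₀ (by positivity)]
    nlinarith
  · rw [real_inner_smul_left]
    split_ifs with hij
    · subst hij
      have : inner ℝ (g i - w) (g i) = ‖g i - w‖ ^ 2 := by
        rw [← real_inner_self_eq_norm_sq, inner_sub_right (g i - w) (g i) w, hwK, sub_zero]
      rw [this]
      field_simp
    · rw [horth i (Finset.mem_erase.2 ⟨hij, hi⟩), mul_zero]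

/-! ### Multipliers and the Lipschitz estimate. -/

/-- Karush-Kuhn-Tucker conditions for the projection `x` of `v`. -/
structure IsMultiplier {ι P H : Type*} [DecidableEq ι] [NormedAddCommGroup H]
    [InnerProductSpace ℝ H] (I₁ I₂ : Finset ι) (f : ι → P → ℝ) (g : ι → P → H) (p : P)
    (v x : H) (μ : ι → ℝ) : Prop where
  sub_eq : v - x = ∑ i ∈ I₁ ∪ I₂, μ i • g i p
  nonneg : ∀ i ∈ I₁ ∪ I₂, i ∉ I₁ → 0 ≤ μ i
  complementary : ∀ i ∈ I₁ ∪ I₂, μ i * (f i p - inner ℝ x (g i p)) = 0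

theorem inner_le_of_mem_feasibleSet {ι P H : Type*} [DecidableEq ι] [NormedAddCommGroup H]
    [InnerProductSpace ℝ H] {I₁ I₂ : Finset ι} {f : ι → P → ℝ} {g : ι → P → H} {p : P} {x : H}
    (hx : x ∈ feasibleSet I₁ I₂ f g p) {i : ι} (hi : i ∈ I₁ ∪ I₂) :
    inner ℝ x (g i p) ≤ f i p := by
  rcases Finset.mem_union.1 hi with h | h
  · exact (hx.1 i h).le
  · exact hx.2 i h

theorem CoeffBound.exists_isMultiplier {ι P H : Type*} [DecidableEq ι] [NormedAddCommGroup H]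
    [InnerProductSpace ℝ H] {I₁ I₂ : Finset ι} {f : ι → P → ℝ} {g : ι → P → H} {p : P}
    {c : ℝ} (hc : 0 < c) (h : CoeffBound (I₁ ∪ I₂) (fun i => g i p) c) {v x : H}
    (hx : IsProjection (feasibleSet I₁ I₂ f g p) v x) :
    ∃ μ, IsMultiplier I₁ I₂ f g p v x μ := by
  rw [isProjection_iff_inner_nonpos (convex_feasibleSet _ _ _ _ _)] at hx
  obtain ⟨hxC, hvar⟩ := hx
  obtain ⟨e, he⟩ := h.exists_biorthogonal hc
  obtain ⟨μ, horth', hwK⟩ := exists_sub_sum_orthogonal (I₁ ∪ I₂) (fun i => g i p) (v - x)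
  obtain ⟨w, hμ⟩ : ∃ w, ∑ i ∈ I₁ ∪ I₂, μ i • g i p = w := ⟨_, rfl⟩
  rw [hμ] at horth' hwK
  have hvw : v - x = w := by
    -- Moving orthogonally to all gradients changes no constraint value.
    have hmem : x + (v - x - w) ∈ feasibleSet I₁ I₂ f g p := by
      refine ⟨fun i hi => ?_, fun i hi => ?_⟩
      · rw [inner_add_left, horth' i (Finset.mem_union_left _ hi), add_zero, hxC.1 i hi]
      · rw [inner_add_left, horth' i (Finset.mem_union_right _ hi), add_zero]
        exact hxC.2 i hi
    have h1 := hvar _ hmem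
    rw [add_sub_cancel_left] at h1
    have h2 : inner ℝ (v - x) (v - x - w) = ‖v - x - w‖ ^ 2 := by
      rw [← real_inner_self_eq_norm_sq, inner_sub_right (v - x - w) (v - x) w, hwK,
        sub_zero, real_inner_comm]
    rw [h2] at h1
    exact sub_eq_zero.1 (norm_eq_zero.1 (pow_eq_zero_iff two_ne_zero |>.1
      (le_antisymm h1 (sq_nonneg _))))
  have hcoef : ∀ j ∈ I₁ ∪ I₂, inner ℝ (v - x) (e j) = μ j := by
    intro j hj
    rw [hvw, ← hμ, real_inner_comm, inner_sum]
    simp_rw [inner_smul_right]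
    rw [Finset.sum_congr rfl fun i hi => by rw [(he j hj).2 i hi]]
    simp only [mul_ite, mul_one, mul_zero]
    rw [Finset.sum_ite_eq' (I₁ ∪ I₂) j μ, if_pos hj]
  -- Moving along `e j` alters the `j`-th constraint value only, so the variational inequality
  -- isolates `μ j`. Taking `t = -1` gives its sign, and `t` equal to the slack gives
  -- complementarity.
  have hstep : ∀ j ∈ I₁ ∪ I₂, ∀ t : ℝ, (j ∈ I₁ → t = 0) → inner ℝ x (g j p) + t ≤ f j p →
      t * μ j ≤ 0 := by
    intro j hj t ht1 ht2
    have hin : ∀ i ∈ I₁ ∪ I₂, inner ℝ (x + t • e j) (g i p) =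
        inner ℝ x (g i p) + if i = j then t else 0 := by
      intro i hi
      rw [inner_add_left, real_inner_smul_left, (he j hj).2 i hi]
      split_ifs <;> simp
    have hmem : x + t • e j ∈ feasibleSet I₁ I₂ f g p := by
      refine ⟨fun i hi => ?_, fun i hi => ?_⟩
      · rw [hin i (Finset.mem_union_left _ hi), hxC.1 i hi]
        split_ifs with hij
        · rw [ht1 (hij ▸ hi), add_zero]
        · rw [add_zero]
      · rw [hin i (Finset.mem_union_right _ hi)]
        split_ifs with hij
        · rw [hij]; exact ht2
        · rw [add_zero]; exact hxC.2 i hi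
    have h1 := hvar _ hmem
    rwa [add_sub_cancel_left, inner_smul_right, hcoef j hj] at h1
  have hnn : ∀ i ∈ I₁ ∪ I₂, i ∉ I₁ → 0 ≤ μ i := by
    intro i hi hi1
    have := hstep i hi (-1) (fun h => absurd h hi1)
      (by linarith [inner_le_of_mem_feasibleSet hxC hi])
    linarith
  refine ⟨μ, hvw.trans hμ.symm, hnn, fun i hi => ?_⟩
  by_cases hi1 : i ∈ I₁
  · rw [hxC.1 i hi1, sub_self, mul_zero]
  · refine le_antisymm ?_ (mul_nonneg (hnn i hi hi1)
      (sub_nonneg.2 (inner_le_of_mem_feasibleSet hxC hi)))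
    rw [mul_comm]
    exact hstep i hi _ (fun h => absurd h hi1) (by linarith)

/-- If `d ≤ e`, then `b d² ≤ b d e` and one factor `e` cancels; otherwise the bound is immediate. -/
theorem le_mul_of_sq_le {e d a b : ℝ} (ha : 0 ≤ a) (hb : 0 ≤ b) (hd : 0 ≤ d)
    (h : e ^ 2 ≤ a * e * d + b * d ^ 2) : e ≤ (1 + a + b) * d := by
  by_contra! hlt
  have h1 : d ≤ e := by nlinarith [mul_nonneg ha hd, mul_nonneg hb hd]
  have h2 : b * d * d ≤ b * d * e := mul_le_mul_of_nonneg_left h1 (mul_nonneg hb hd)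
  have he : 0 < e := by nlinarith [mul_nonneg ha hd, mul_nonneg hb hd]
  nlinarith [mul_lt_mul_of_pos_right hlt he, mul_nonneg hd he.le]

/-- Lipschitz dependence of the projection on the parameter, for fixed `v`. -/
theorem IsMultiplier.norm_sub_le {ι P H : Type*} [DecidableEq ι] [NormedAddCommGroup H]
    [InnerProductSpace ℝ H] {I₁ I₂ : Finset ι} {f : ι → P → ℝ} {g : ι → P → H} {p₁ p₂ : P}
    {v x₁ x₂ : H} {μ₁ μ₂ : ι → ℝ} {c L d B M : ℝ}
    (hx₁ : x₁ ∈ feasibleSet I₁ I₂ f g p₁) (hx₂ : x₂ ∈ feasibleSet I₁ I₂ f g p₂)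
    (h₁ : IsMultiplier I₁ I₂ f g p₁ v x₁ μ₁) (h₂ : IsMultiplier I₁ I₂ f g p₂ v x₂ μ₂)
    (hc : 0 < c) (hL : 0 ≤ L) (hd : 0 ≤ d)
    (hcb : CoeffBound (I₁ ∪ I₂) (fun i => g i p₂) c)
    (hf : ∀ i ∈ I₁ ∪ I₂, |f i p₁ - f i p₂| ≤ L * d)
    (hg : ∀ i ∈ I₁ ∪ I₂, ‖g i p₁ - g i p₂‖ ≤ L * d)
    (hB : ‖x₁‖ ≤ B) (hM : ∑ i ∈ I₁ ∪ I₂, |μ₁ i| ≤ M) :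
    ‖x₁ - x₂‖ ≤ (1 + (c * (1 + B) * L + M * L) + c * M * L ^ 2 * (1 + B)) * d := by
  have hB0 : 0 ≤ B := (norm_nonneg _).trans hB
  have hM0 : 0 ≤ M := (Finset.sum_nonneg fun i _ => abs_nonneg _).trans hM
  set e := ‖x₁ - x₂‖ with he
  have he0 : 0 ≤ e := norm_nonneg _
  have hLd : 0 ≤ L * d := mul_nonneg hL hd
  have hdiff : ∑ i ∈ I₁ ∪ I₂, |μ₂ i - μ₁ i| ≤ c * (e + M * (L * d)) := by
    refine (hcb fun i => μ₂ i - μ₁ i).trans (mul_le_mul_of_nonneg_left ?_ hc.le)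
    have h3 : ∑ i ∈ I₁ ∪ I₂, (μ₂ i - μ₁ i) • g i p₂ =
        (x₁ - x₂) + ∑ i ∈ I₁ ∪ I₂, μ₁ i • (g i p₁ - g i p₂) := by
      have : x₁ - x₂ = (v - x₂) - (v - x₁) := by abel
      rw [this, h₁.sub_eq, h₂.sub_eq, ← Finset.sum_sub_distrib, ← Finset.sum_add_distrib]
      exact Finset.sum_congr rfl fun i _ => by rw [sub_smul, smul_sub]; abel
    rw [h3]
    refine (norm_add_le _ _).trans (add_le_add le_rfl ?_)
    refine (norm_sum_le_of_le _ (f := fun i => μ₁ i • (g i p₁ - g i p₂))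
      (n := fun i => |μ₁ i| * (L * d)) fun i hi => ?_).trans ?_
    · rw [norm_smul, Real.norm_eq_abs]
      exact mul_le_mul_of_nonneg_left (hg i hi) (abs_nonneg _)
    · rw [← Finset.sum_mul]
      exact mul_le_mul_of_nonneg_right hM hLd
  have hfeas : ∀ {q : P} {y z : H} {ν : ι → ℝ} {q' : P}, y ∈ feasibleSet I₁ I₂ f g q →
      IsMultiplier I₁ I₂ f g q' v z ν → ∀ i ∈ I₁ ∪ I₂, ν i * inner ℝ y (g i q) ≤ ν i * f i q := by
    intro q y z ν q' hy hν i hi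
    by_cases hi1 : i ∈ I₁
    · rw [hy.1 i hi1]
    · exact mul_le_mul_of_nonneg_left (inner_le_of_mem_feasibleSet hy hi) (hν.nonneg i hi hi1)
  -- Complementarity and cross-feasibility cancel the leading terms. Each remaining data increment
  -- is multiplied by a multiplier difference or by `x₁ - x₂`, which makes the estimate quadratic.
  have hterm : ∀ i ∈ I₁ ∪ I₂,
      μ₂ i * inner ℝ (x₁ - x₂) (g i p₂) - μ₁ i * inner ℝ (x₁ - x₂) (g i p₁) ≤
        |μ₂ i - μ₁ i| * ((1 + B) * (L * d)) + |μ₁ i| * (e * (L * d)) := by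
    intro i hi
    have a1 := hfeas hx₁ h₂ i hi
    have a2 := hfeas hx₂ h₁ i hi
    have b1 := h₁.complementary i hi
    have b2 := h₂.complementary i hi
    have c1 : (μ₂ i - μ₁ i) * (f i p₁ - f i p₂) ≤ |μ₂ i - μ₁ i| * (L * d) := by
      refine (le_abs_self _).trans ?_
      rw [abs_mul]
      exact mul_le_mul_of_nonneg_left (hf i hi) (abs_nonneg _)
    have c2 : (μ₁ i - μ₂ i) * inner ℝ x₁ (g i p₁ - g i p₂) ≤ |μ₂ i - μ₁ i| * (B * (L * d)) := by
      refine (le_abs_self _).trans ?_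
      rw [abs_mul, abs_sub_comm]
      refine mul_le_mul_of_nonneg_left ?_ (abs_nonneg _)
      exact (abs_real_inner_le_norm _ _).trans
        (mul_le_mul hB (hg i hi) (norm_nonneg _) hB0)
    have c3 : -μ₁ i * inner ℝ (x₁ - x₂) (g i p₁ - g i p₂) ≤ |μ₁ i| * (e * (L * d)) := by
      refine (le_abs_self _).trans ?_
      rw [abs_mul, abs_neg]
      refine mul_le_mul_of_nonneg_left ?_ (abs_nonneg _)
      exact (abs_real_inner_le_norm _ _).trans
        (mul_le_mul_of_nonneg_left (hg i hi) he0)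
    simp only [inner_sub_left, inner_sub_right] at *
    linarith
  have hsq : e ^ 2 = ∑ i ∈ I₁ ∪ I₂,
      (μ₂ i * inner ℝ (x₁ - x₂) (g i p₂) - μ₁ i * inner ℝ (x₁ - x₂) (g i p₁)) := by
    rw [he, ← real_inner_self_eq_norm_sq]
    have : inner ℝ (x₁ - x₂) (x₁ - x₂) = inner ℝ (x₁ - x₂) ((v - x₂) - (v - x₁)) := by
      congr 1; abel
    rw [this, inner_sub_right, h₁.sub_eq, h₂.sub_eq, inner_sum, inner_sum,
      ← Finset.sum_sub_distrib]
    simp_rw [inner_smul_right]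
  have hle : e ^ 2 ≤ c * (e + M * (L * d)) * ((1 + B) * (L * d)) + M * (e * (L * d)) := by
    rw [hsq]
    refine (Finset.sum_le_sum hterm).trans ?_
    rw [Finset.sum_add_distrib, ← Finset.sum_mul, ← Finset.sum_mul]
    exact add_le_add (mul_le_mul_of_nonneg_right hdiff (by positivity))
      (mul_le_mul_of_nonneg_right hM (by positivity))
  refine le_mul_of_sq_le (by positivity) (by positivity) hd (hle.trans (le_of_eq ?_))
  ring

/-! ### Uniform constants near the base parameter. -/

theorem LocallyLipschitz.exists_finset_bound {ι X Y : Type*} [PseudoMetricSpace X]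
    [PseudoMetricSpace Y] (s : Finset ι) {f : ι → X → Y} (hf : ∀ i ∈ s, LocallyLipschitz (f i))
    (x : X) : ∃ L : ℝ, 0 ≤ L ∧ ∃ t ∈ nhds x, ∀ i ∈ s, ∀ p ∈ t, ∀ q ∈ t,
      dist (f i p) (f i q) ≤ L * dist p q := by
  classical
  induction s using Finset.induction_on with
  | empty => exact ⟨0, le_rfl, Set.univ, Filter.univ_mem, by simp⟩
  | insert a s _ ih =>
    obtain ⟨L, hL, t, ht, h⟩ := ih fun i hi => hf i (Finset.mem_insert_of_mem hi)
    obtain ⟨K, u, hu, hK⟩ := hf a (Finset.mem_insert_self a s) x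
    refine ⟨L + K, by positivity, t ∩ u, Filter.inter_mem ht hu, fun i hi p hp q hq => ?_⟩
    rw [add_mul]
    rcases Finset.mem_insert.1 hi with rfl | hi
    · exact (hK.dist_le_mul p hp.2 q hq.2).trans (le_add_of_nonneg_left (by positivity))
    · exact (h i hi p hp.1 q hq.1).trans (le_add_of_nonneg_right (by positivity))

/-- The projection onto a feasible set all of whose gradients are linearly independent at `p₀`
is Lipschitz in the parameter near `p₀`, uniformly for `v` in a ball. -/
theorem exists_lipschitz_projection {ι P H : Type*} [DecidableEq ι] [PseudoMetricSpace P]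
    [NormedAddCommGroup H] [InnerProductSpace ℝ H] [CompleteSpace H]
    {I₁ I₂ : Finset ι} {f : ι → P → ℝ} {g : ι → P → H}
    (hf : ∀ i ∈ I₁ ∪ I₂, LocallyLipschitz (f i)) (hg : ∀ i ∈ I₁ ∪ I₂, LocallyLipschitz (g i))
    (p₀ : P) (hli : LinearIndependent ℝ (fun i : (I₁ ∪ I₂ : Finset ι) => g i p₀)) (R : ℝ) :
    ∃ K : ℝ, 0 ≤ K ∧ ∃ U ∈ nhds p₀, (∀ p ∈ U, (feasibleSet I₁ I₂ f g p).Nonempty) ∧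
      ∀ v : H, ‖v‖ ≤ R → ∀ p₁ ∈ U, ∀ p₂ ∈ U,
        ‖projection (feasibleSet I₁ I₂ f g p₁) v - projection (feasibleSet I₁ I₂ f g p₂) v‖ ≤
          K * dist p₁ p₂ := by
  obtain ⟨c₀, hc₀, hcb₀⟩ := hli.exists_coeffBound (g := fun i => g i p₀)
  obtain ⟨Lf, hLf, tf, htf, hLipf⟩ := LocallyLipschitz.exists_finset_bound _ hf p₀
  obtain ⟨Lg, hLg, tg, htg, hLipg⟩ := LocallyLipschitz.exists_finset_bound _ hg p₀
  have hnear : ∀ᶠ p in nhds p₀, ∀ i ∈ I₁ ∪ I₂, ‖g i p₀ - g i p‖ ≤ 1 / (2 * c₀) := by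
    rw [Filter.eventually_all_finset]
    intro i hi
    have := (hg i hi).continuous.continuousAt (x := p₀)
    filter_upwards [this (Metric.closedBall_mem_nhds (g i p₀) (ε := 1 / (2 * c₀))
      (by positivity))] with p hp
    rw [← dist_eq_norm, dist_comm]
    exact hp
  have hF : ∀ᶠ p in nhds p₀, ∑ i ∈ I₁ ∪ I₂, |f i p| ≤ ∑ i ∈ I₁ ∪ I₂, |f i p₀| + 1 := by
    have : Continuous fun p => ∑ i ∈ I₁ ∪ I₂, |f i p| :=
      continuous_finsetSum _ fun i hi => (hf i hi).continuous.abs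
    exact (this.continuousAt.eventually_lt continuousAt_const (lt_add_one _)).mono
      fun p hp => hp.le
  set F := ∑ i ∈ I₁ ∪ I₂, |f i p₀| + 1 with hFdef
  have hF0 : 0 ≤ F := by
    have : 0 ≤ ∑ i ∈ I₁ ∪ I₂, |f i p₀| := Finset.sum_nonneg fun i _ => abs_nonneg _
    linarith
  have hc : 0 < 2 * c₀ := by positivity
  have hU : tf ∩ tg ∩ ({p | ∀ i ∈ I₁ ∪ I₂, ‖g i p₀ - g i p‖ ≤ 1 / (2 * c₀)} ∩
      {p | ∑ i ∈ I₁ ∪ I₂, |f i p| ≤ F}) ∈ nhds p₀ :=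
    Filter.inter_mem (Filter.inter_mem htf htg) (Filter.inter_mem hnear hF)
  set U := tf ∩ tg ∩ ({p | ∀ i ∈ I₁ ∪ I₂, ‖g i p₀ - g i p‖ ≤ 1 / (2 * c₀)} ∩
      {p | ∑ i ∈ I₁ ∪ I₂, |f i p| ≤ F})
  have hcb : ∀ p ∈ U, CoeffBound (I₁ ∪ I₂) (fun i => g i p) (2 * c₀) := fun p hp =>
    hcb₀.of_near hc₀ hp.2.1
  -- The biorthogonal family solves all constraints with equality, at a norm uniform in `p`.
  have hpt : ∀ p ∈ U, ∃ y ∈ feasibleSet I₁ I₂ f g p, ‖y‖ ≤ F * (2 * c₀) := by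
    intro p hp
    obtain ⟨e, he⟩ := (hcb p hp).exists_biorthogonal hc
    have hy : ∀ i ∈ I₁ ∪ I₂, inner ℝ (∑ j ∈ I₁ ∪ I₂, f j p • e j) (g i p) = f i p := by
      intro i hi
      rw [sum_inner]
      simp_rw [real_inner_smul_left]
      rw [Finset.sum_congr rfl fun j hj => by rw [(he j hj).2 i hi]]
      simp only [mul_ite, mul_one, mul_zero]
      rw [Finset.sum_ite_eq (I₁ ∪ I₂) i (fun j => f j p), if_pos hi]
    refine ⟨∑ j ∈ I₁ ∪ I₂, f j p • e j, ⟨fun i hi => hy i (Finset.mem_union_left _ hi),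
      fun i hi => (hy i (Finset.mem_union_right _ hi)).le⟩, ?_⟩
    refine (norm_sum_le_of_le _ (f := fun j => f j p • e j)
      (n := fun j => |f j p| * (2 * c₀)) fun j hj => ?_).trans ?_
    · rw [norm_smul, Real.norm_eq_abs]
      exact mul_le_mul_of_nonneg_left (he j hj).1 (abs_nonneg _)
    · rw [← Finset.sum_mul]
      exact mul_le_mul_of_nonneg_right hp.2.2 hc.le
  have hne : ∀ p ∈ U, (feasibleSet I₁ I₂ f g p).Nonempty := fun p hp =>
    let ⟨y, hy, _⟩ := hpt p hp; ⟨y, hy⟩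
  have hdist : ∀ v : H, ‖v‖ ≤ R → ∀ p ∈ U,
      ‖v - projection (feasibleSet I₁ I₂ f g p) v‖ ≤ F * (2 * c₀) + R := by
    intro v hv p hp
    obtain ⟨y, hy, hyn⟩ := hpt p hp
    have h1 : (1 / 2 : ℝ) * ‖projection (feasibleSet I₁ I₂ f g p) v - v‖ ^ 2 ≤
        1 / 2 * ‖y - v‖ ^ 2 := (isProjection_projection_feasibleSet (hne p hp) v).2 hy
    rw [norm_sub_rev]
    exact (le_of_sq_le_sq (by linarith) (norm_nonneg _)).trans
      ((norm_sub_le y v).trans (add_le_add hyn hv))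
  by_cases hR : 0 ≤ R
  swap
  · exact ⟨0, le_rfl, U, hU, hne, fun v hv => absurd ((norm_nonneg v).trans hv) hR⟩
  -- The constant of `IsMultiplier.norm_sub_le` with `c = 2c₀`, `L = Lf + Lg`, `B = R + (F · 2c₀ +
  -- R)` and `M = 2c₀ (F · 2c₀ + R)`.
  refine ⟨1 + (2 * c₀ * (1 + (R + (F * (2 * c₀) + R))) * (Lf + Lg) +
    2 * c₀ * (F * (2 * c₀) + R) * (Lf + Lg)) + 2 * c₀ * (2 * c₀ * (F * (2 * c₀) + R)) *
      (Lf + Lg) ^ 2 * (1 + (R + (F * (2 * c₀) + R))), by positivity, U, hU, hne, ?_⟩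
  intro v hv p₁ hp₁ p₂ hp₂
  have hx₁ := isProjection_projection_feasibleSet (hne p₁ hp₁) v
  have hx₂ := isProjection_projection_feasibleSet (hne p₂ hp₂) v
  obtain ⟨μ₁, hμ₁⟩ := (hcb p₁ hp₁).exists_isMultiplier hc hx₁
  obtain ⟨μ₂, hμ₂⟩ := (hcb p₂ hp₂).exists_isMultiplier hc hx₂
  refine hμ₁.norm_sub_le hx₁.1 hx₂.1 hμ₂ hc (add_nonneg hLf hLg) dist_nonneg (hcb p₂ hp₂)
    (fun i hi => ?_) (fun i hi => ?_) ?_ ?_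
  · rw [← Real.dist_eq]
    exact (hLipf i hi p₁ hp₁.1.1 p₂ hp₂.1.1).trans
      (mul_le_mul_of_nonneg_right (le_add_of_nonneg_right hLg) dist_nonneg)
  · rw [← dist_eq_norm]
    exact (hLipg i hi p₁ hp₁.1.2 p₂ hp₂.1.2).trans
      (mul_le_mul_of_nonneg_right (le_add_of_nonneg_left hLf) dist_nonneg)
  · have := norm_sub_le v (v - projection (feasibleSet I₁ I₂ f g p₁) v)
    rw [sub_sub_cancel] at this
    exact this.trans (add_le_add hv (hdist v hv p₁ hp₁))
  · refine (hcb p₁ hp₁ μ₁).trans (mul_le_mul_of_nonneg_left ?_ hc.le)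
    rw [← hμ₁.sub_eq]
    exact hdist v hv p₁ hp₁

/-! ### Reduction to the active constraints. -/

/-- Dropping inequalities that are inactive at the projection does not change the projection. -/
theorem IsProjection.of_inactive {ι P H : Type*} [NormedAddCommGroup H]
    [InnerProductSpace ℝ H] {I₁ I₂ J : Finset ι} {f : ι → P → ℝ} {g : ι → P → H} {p : P}
    {v x : H} (hJ : J ⊆ I₂) (hx : IsProjection (feasibleSet I₁ I₂ f g p) v x)
    (hin : ∀ i ∈ I₂, i ∉ J → inner ℝ x (g i p) < f i p) :
    IsProjection (feasibleSet I₁ J f g p) v x := by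
  rw [isProjection_iff_inner_nonpos (convex_feasibleSet _ _ _ _ _)] at hx ⊢
  have hxJ : x ∈ feasibleSet I₁ J f g p := ⟨hx.1.1, fun i hi => hx.1.2 i (hJ hi)⟩
  refine ⟨hxJ, fun y hy => ?_⟩
  -- A short step from `x` towards `y` keeps the inactive inequalities strict; the variational
  -- inequality is homogeneous in the step length.
  have hev : ∀ᶠ t : ℝ in nhdsWithin 0 (Set.Ioi 0), ∀ i ∈ I₂, i ∉ J →
      inner ℝ (x + t • (y - x)) (g i p) < f i p := by
    rw [Filter.eventually_all_finset]
    intro i hi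
    by_cases hiJ : i ∈ J
    · exact Filter.Eventually.of_forall fun t h => absurd hiJ h
    have hcont : Continuous fun t : ℝ => inner ℝ (x + t • (y - x)) (g i p) := by fun_prop
    have := hcont.continuousAt.eventually_lt (continuousAt_const (x := (0 : ℝ)) (y := f i p))
      (by simpa using hin i hi hiJ)
    exact (this.filter_mono nhdsWithin_le_nhds).mono fun t ht _ => ht
  obtain ⟨t, ⟨ht, ht1⟩, ht0⟩ := ((hev.and ((eventually_le_nhds (zero_lt_one (α := ℝ))).filter_mono
    nhdsWithin_le_nhds)).and self_mem_nhdsWithin).exists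
  have ht0' : 0 < t := ht0
  have hmemJ : x + t • (y - x) ∈ feasibleSet I₁ J f g p :=
    (convex_feasibleSet I₁ J f g p).add_smul_sub_mem hxJ hy ⟨ht0'.le, ht1⟩
  have hmem : x + t • (y - x) ∈ feasibleSet I₁ I₂ f g p := by
    refine ⟨hmemJ.1, fun i hi => ?_⟩
    by_cases hiJ : i ∈ J
    · exact hmemJ.2 i hiJ
    · exact (ht i hi hiJ).le
  have h := hx.2 _ hmem
  rw [add_sub_cancel_left, inner_smul_right] at h
  exact nonpos_of_mul_nonpos_right h ht0'

theorem theorem5p5 {H G ι : Type*}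
    [NormedAddCommGroup H] [InnerProductSpace ℝ H] [CompleteSpace H]
    [NormedAddCommGroup G] [NormedSpace ℝ G]
    (D : Set G) (I₁ I₂ : Finset ι) (f : ι → D → ℝ) (g : ι → D → H)
    (hf : ∀ i, i ∈ I₁ ∨ i ∈ I₂ → LocallyLipschitz (f i))
    (hg : ∀ i, i ∈ I₁ ∨ i ∈ I₂ → LocallyLipschitz (g i))
    (pbar : D) (vbar : H)
    (hne : (feasibleSet I₁ I₂ f g pbar).Nonempty)
    (hv : vbar ∉ feasibleSet I₁ I₂ f g pbar)
    (hLICQ : LICQ I₁ I₂ f g pbar (projection (feasibleSet I₁ I₂ f g pbar) vbar)) :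
    ∃ W ∈ nhds vbar, ∃ U ∈ nhds pbar,
      (∀ p ∈ U, (feasibleSet I₁ I₂ f g p).Nonempty) ∧
      ∃ l₀ : ℝ, 0 < l₀ ∧ ∀ v₁ ∈ W, ∀ v₂ ∈ W, ∀ p₁ ∈ U, ∀ p₂ ∈ U,
        ‖(v₁ - v₂) - (2 : ℝ) • (projection (feasibleSet I₁ I₂ f g p₁) v₁ -
            projection (feasibleSet I₁ I₂ f g p₂) v₂)‖
          ≤ ‖v₁ - v₂‖ + l₀ * ‖(p₁ : G) - (p₂ : G)‖ := by
  classical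
  obtain ⟨J, hJdef⟩ : ∃ J : Finset ι, J = I₂.filter fun i => inner ℝ
    (projection (feasibleSet I₁ I₂ f g pbar) vbar) (g i pbar) = f i pbar := ⟨_, rfl⟩
  have hxbar := isProjection_projection_feasibleSet hne vbar
  set xbar := projection (feasibleSet I₁ I₂ f g pbar) vbar with hxbar_def
  have hJ : J ⊆ I₂ := hJdef ▸ Finset.filter_subset _ _
  have hmemJ : ∀ {i}, i ∈ J ↔ i ∈ I₂ ∧ inner ℝ xbar (g i pbar) = f i pbar := by
    intro i; rw [hJdef, Finset.mem_filter]
  have hin : ∀ i ∈ I₂, i ∉ J → inner ℝ xbar (g i pbar) < f i pbar := fun i hi hiJ =>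
    lt_of_le_of_ne (hxbar.1.2 i hi) fun h => hiJ (hmemJ.2 ⟨hi, h⟩)
  have hor : ∀ i ∈ I₁ ∪ J, i ∈ I₁ ∨ i ∈ I₂ := fun i hi =>
    (Finset.mem_union.1 hi).imp id fun h => hJ h
  have hact : ∀ i ∈ I₁ ∪ J, i ∈ activeSet I₁ I₂ f g pbar xbar := fun i hi =>
    ⟨hor i hi, (Finset.mem_union.1 hi).elim (hxbar.1.1 i) fun h => (hmemJ.1 h).2⟩
  have hli : LinearIndependent ℝ (fun i : (I₁ ∪ J : Finset ι) => g i pbar) :=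
    LinearIndependent.comp hLICQ (fun i : (I₁ ∪ J : Finset ι) => ⟨i.1, hact i.1 i.2⟩)
      fun i j hij => Subtype.ext (Subtype.mk.inj hij)
  obtain ⟨K, hK, U, hU, hneU, hlip⟩ := exists_lipschitz_projection
    (fun i hi => hf i (hor i hi)) (fun i hi => hg i (hor i hi)) pbar hli (‖vbar‖ + 1)
  have hbar : projection (feasibleSet I₁ J f g pbar) vbar = xbar :=
    (hxbar.of_inactive hJ hin).projection_eq (convex_feasibleSet _ _ _ _ _)
  have hball : ∀ v ∈ Metric.ball vbar 1, ‖v‖ ≤ ‖vbar‖ + 1 := by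
    intro v hv
    have h1 := norm_le_norm_add_norm_sub' v vbar
    have h2 := mem_ball_iff_norm.1 hv
    linarith
  -- Joint continuity: nonexpansive in `v` at fixed `p`, Lipschitz in `p` at `vbar`.
  have htend : Filter.Tendsto (fun z : H × D => (projection (feasibleSet I₁ J f g z.2) z.1, z.2))
      (nhds (vbar, pbar)) (nhds (xbar, pbar)) := by
    refine Filter.Tendsto.prodMk_nhds ?_ (continuous_snd.tendsto _)
    rw [tendsto_iff_norm_sub_tendsto_zero]
    have hlim : Filter.Tendsto (fun z : H × D => ‖z.1 - vbar‖ + K * dist z.2 pbar)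
        (nhds (vbar, pbar)) (nhds 0) := by
      have : Continuous fun z : H × D => ‖z.1 - vbar‖ + K * dist z.2 pbar := by fun_prop
      simpa using this.tendsto (vbar, pbar)
    refine squeeze_zero' (Filter.Eventually.of_forall fun _ => norm_nonneg _) ?_ hlim
    filter_upwards [prod_mem_nhds Filter.univ_mem hU] with z hz
    have hpU := mem_of_mem_nhds hU
    have h1 := (isProjection_projection_feasibleSet (hneU _ hz.2) z.1).norm_sub_le
      (convex_feasibleSet _ _ _ _ _) (isProjection_projection_feasibleSet (hneU _ hz.2) vbar)
    have h2 := hlip vbar (by linarith) z.2 hz.2 pbar hpU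
    rw [hbar] at h2
    exact (norm_sub_le_norm_sub_add_norm_sub _ _ _).trans (add_le_add h1 h2)
  have hstrict : ∀ᶠ z : H × D in nhds (xbar, pbar), ∀ i ∈ I₂, i ∉ J →
      inner ℝ z.1 (g i z.2) < f i z.2 := by
    rw [Filter.eventually_all_finset]
    intro i hi
    by_cases hiJ : i ∈ J
    · exact Filter.Eventually.of_forall fun t h => absurd hiJ h
    have hfc := (hf i (Or.inr hi)).continuous
    have hgc := (hg i (Or.inr hi)).continuous
    have c1 : Continuous fun z : H × D => inner ℝ z.1 (g i z.2) := by fun_prop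
    have c2 : Continuous fun z : H × D => f i z.2 := by fun_prop
    exact (c1.continuousAt.eventually_lt c2.continuousAt (hin i hi hiJ)).mono fun z hz _ => hz
  obtain ⟨W, hW, V, hV, hWV⟩ := mem_nhds_prod_iff.1 (htend.eventually hstrict)
  have hproj : ∀ v ∈ W, ∀ p ∈ U ∩ V, IsProjection (feasibleSet I₁ I₂ f g p) v
      (projection (feasibleSet I₁ J f g p) v) := by
    intro v hv p hp
    have h := isProjection_projection_feasibleSet (hneU p hp.1) v
    have hs := hWV (Set.mk_mem_prod hv hp.2)
    -- A minimizer over the larger reduced set that lies in the full set also minimizes there.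
    refine ⟨⟨h.1.1, fun i hi => ?_⟩, fun y hy => h.2 ⟨hy.1, fun i hi => hy.2 i (hJ hi)⟩⟩
    by_cases hiJ : i ∈ J
    · exact h.1.2 i hiJ
    · exact (hs i hi hiJ).le
  refine ⟨W ∩ Metric.ball vbar 1, Filter.inter_mem hW (Metric.ball_mem_nhds _ one_pos), U ∩ V,
    Filter.inter_mem hU hV, fun p hp => ⟨_, (hproj vbar (mem_of_mem_nhds hW) p hp).1⟩,
    -- `2 * K` is what the estimate needs; the `+ 1` ensures positivity when `K = 0`.
    2 * K + 1, by positivity, ?_⟩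
  intro v₁ hv₁ v₂ hv₂ p₁ hp₁ p₂ hp₂
  rw [(hproj v₁ hv₁.1 p₁ hp₁).projection_eq (convex_feasibleSet _ _ _ _ _),
    (hproj v₂ hv₂.1 p₂ hp₂).projection_eq (convex_feasibleSet _ _ _ _ _)]
  have h1 := (isProjection_projection_feasibleSet (hneU p₁ hp₁.1) v₁).norm_reflection_sub_le
    (convex_feasibleSet _ _ _ _ _) (isProjection_projection_feasibleSet (hneU p₁ hp₁.1) v₂)
  have h2 := hlip v₂ (hball v₂ hv₂.2) p₁ hp₁.1 p₂ hp₂.1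
  rw [Subtype.dist_eq, dist_eq_norm] at h2
  set a := projection (feasibleSet I₁ J f g p₁) v₁
  set b := projection (feasibleSet I₁ J f g p₁) v₂
  set c := projection (feasibleSet I₁ J f g p₂) v₂
  -- Split at `b`: change `v` at fixed `p₁`, then `p` at fixed `v₂`.
  have h3 : (v₁ - v₂) - (2 : ℝ) • (a - c) =
      ((v₁ - v₂) - (2 : ℝ) • (a - b)) - (2 : ℝ) • (b - c) := by module
  have h4 := norm_sub_le ((v₁ - v₂) - (2 : ℝ) • (a - b)) ((2 : ℝ) • (b - c))
  rw [← h3, norm_smul, Real.norm_ofNat] at h4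
  have h5 := norm_nonneg ((p₁ : G) - (p₂ : G))
  linarith
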